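/- Let $p\geq 2$ be a prime number, let $\mathbb{C}_p$ be the completion of an algebraic closure of $\mathbb{Q}_p$ with its absolute value $|\cdot|_p$, and let $d\geq 2$ be an integer. For $c\in\mathbb{C}_p$ define $f_c(z):=z^d+c$, viewed as a self-map of $\mathbb{P}^1(\mathbb{C}_p)=\mathbb{C}_p\cup\{\infty\}$. Call $f_c$ postcritically finite (PCF) if every critical point $x\in\mathbb{P}^1(\mathbb{C}_p)$ of $f_c$ (that is, every point where $f_c$ has multiplicity at least $2$) is preperiodic, i.e. $f_c^n(x)=f_c^m(x)$ for some integers $n>m\geq 0$, where $f_c^n$ denotes the $n$-th iterate. If $c\in\mathbb{C}_p$ is a parameter for which $f_c$ is PCF, then $|c|_p\leq 1$. Moreover, for any $a\in\mathbb{C}_p$ with $|a|_p\leq 1$ and any radius $0<s<1$, there are only finitely many $c$ in the closed disk $\bar{D}(a,s)=\{x\in\mathbb{C}_p : |x-a|_p\leq s\}$ such that $f_c$ is PCF. -/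

import Mathlib

open scoped OnePoint

noncomputable section

namespace RatDyn

variable {K : Type*} [Field K]

/-- The degree of a rational function: the maximum of the degrees of its numerator and
denominator in lowest terms. -/
def degree (f : RatFunc K) : ℕ :=
  max f.num.natDegree f.denom.natDegree

/-- The point `[a : b]` of the projective line `ℙ¹(K) = K ∪ {∞}`, for `(a, b) ≠ (0, 0)`. -/
def ratio (a b : K) : OnePoint K :=
  open Classical in if b = 0 then ∞ else ((a / b : K) : OnePoint K)

/-- The self-map of `ℙ¹(K) = K ∪ {∞}` induced by a rational function `f = g / h` in lowest terms.
The value at `∞` is read off from the coefficients of `g` and `h` in degree `deg f`. -/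
def toMap (f : RatFunc K) : OnePoint K → OnePoint K
  | ∞ => ratio (f.num.coeff (degree f)) (f.denom.coeff (degree f))
  | (x : K) => ratio (f.num.eval x) (f.denom.eval x)

/-- For `f = g / h` in lowest terms, a polynomial whose zeros are the finite solutions of
`f(x) = y`, counted with multiplicity: `g - y h` for finite `y`, and `h` for `y = ∞`. -/
def fiberPoly (f : RatFunc K) : OnePoint K → Polynomial K
  | ∞ => f.denom
  | (y : K) => f.num - Polynomial.C y * f.denom

/-- The multiplicity (ramification index) with which a nonconstant `f` takes the value `f(x)` at the
point `x ∈ ℙ¹(K)`. At `x = ∞` it is the order of vanishing at `∞` of the degree `deg f`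
homogenization of the fiber polynomial. -/
def multiplicity (f : RatFunc K) : OnePoint K → ℕ
  | ∞ => degree f - (fiberPoly f (toMap f ∞)).natDegree
  | (x : K) => (fiberPoly f (toMap f (x : OnePoint K))).rootMultiplicity x

/-- A critical point of `f` is a point of `ℙ¹(K)` where `f` has multiplicity at least `2`. -/
def IsCriticalPoint (f : RatFunc K) (x : OnePoint K) : Prop :=
  2 ≤ multiplicity f x

/-- `x` is preperiodic under `F` if `Fⁿ(x) = Fᵐ(x)` for some `n > m ≥ 0`. -/
def IsPreperiodic {X : Type*} (F : X → X) (x : X) : Prop :=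
  ∃ m n : ℕ, m < n ∧ F^[n] x = F^[m] x

/-- A rational function over an algebraically closed field is postcritically finite (PCF) if
each of its critical points in `ℙ¹(K)` is preperiodic. -/
def IsPCF [IsAlgClosed K] (f : RatFunc K) : Prop :=
  ∀ x : OnePoint K, IsCriticalPoint f x → IsPreperiodic (toMap f) x

/-- The unicritical polynomial `f_c(z) = z ^ d + c`, as a rational function. -/
def unicritical (d : ℕ) (c : K) : RatFunc K :=
  RatFunc.X ^ d + RatFunc.C c

end RatDyn

end

/-! Only the critical point 0 matters: PCF makes its orbit `critOrbit d c` preperiodic. If |c| > 1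
the norms along this orbit strictly increase (`critOrbit_injective`), which gives the first claim.

For finiteness, `exists_bound` finds one pair `T`, `N` such that f_c^(T+N)(0) = f_c^T(0) for every c
in the disk with 0 preperiodic. This is a nonzero polynomial equation in c, so it has finitely many
roots (`finite_setOf_critOrbit_eq`).

The uniform bound rests on the residue orbit of 0, which is the same for all c in the disk. If 0 is
periodic modulo the maximal ideal, or if |d| < 1, an iterate contracts near the residue cycle. A
preperiodic orbit must then land exactly on an `N`-cycle; it cannot land late, because the step
before landing would have two distinct points with equal d-th powers, and such points are at least
|d||z| apart. Otherwise the multiplier along the residue cycle is a unit. As a is algebraic over 𝔽_p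
in the residue field, pigeonhole yields an iterate that preserves a disk and has derivative near 1.
Taking p-power iterates brings it so close to the identity that its periodic points are fixed and it
is injective, so the orbit is already periodic once it enters the disk. -/

namespace RatDyn

/-! ### Ultrametric estimates and maps close to the identity. -/

section NearId

variable {K : Type*} [NormedField K]

/-- `g` maps `U` to itself, moves points by at most `σ`, and has a `1`-Lipschitz
divided difference which is `δ`-close to `1`. -/
structure NearId (U : Set K) (g : K → K) (σ δ : ℝ) : Prop where
  mapsTo : Set.MapsTo g U U
  norm_sub_le : ∀ z ∈ U, ‖g z - z‖ ≤ σ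
  exists_slope : ∃ Φ : K → K → K, (∀ z ∈ U, ∀ w ∈ U, g z - g w = (z - w) * Φ z w) ∧
    (∀ z ∈ U, ∀ w ∈ U, ‖Φ z w - 1‖ ≤ δ) ∧
    ∀ C, ∀ z ∈ U, ∀ w ∈ U, ∀ z' ∈ U, ∀ w' ∈ U, ‖z - z'‖ ≤ C → ‖w - w'‖ ≤ C →
      ‖Φ z w - Φ z' w'‖ ≤ C

namespace NearId

variable {U : Set K} {g : K → K} {σ δ : ℝ}

theorem mono (h : NearId U g σ δ) {σ' δ' : ℝ} (hσ : σ ≤ σ') (hδ : δ ≤ δ') :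
    NearId U g σ' δ' := by
  obtain ⟨h1, h2, Φ, h3, h4, h5⟩ := h
  exact ⟨h1, fun z hz => (h2 z hz).trans hσ, Φ, h3, fun z hz w hw => (h4 z hz w hw).trans hδ, h5⟩

theorem norm_displacement_sub_le (h : NearId U g σ δ) :
    ∀ z ∈ U, ∀ w ∈ U, ‖(g z - z) - (g w - w)‖ ≤ δ * ‖z - w‖ := by
  obtain ⟨h1, h2, Φ, h3, h4, h5⟩ := h
  intro z hz w hw
  have : (g z - z) - (g w - w) = (Φ z w - 1) * (z - w) := by
    linear_combination h3 z hz w hw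
  rw [this, norm_mul]
  exact mul_le_mul_of_nonneg_right (h4 z hz w hw) (norm_nonneg _)

end NearId

end NearId

section Ultrametric

variable {K : Type*} [NormedField K] [IsUltrametricDist K]

theorem norm_add_le_of_le {x y : K} {C : ℝ} (hx : ‖x‖ ≤ C) (hy : ‖y‖ ≤ C) : ‖x + y‖ ≤ C :=
  (IsUltrametricDist.norm_add_le_max x y).trans (max_le hx hy)

theorem norm_sub_le_trans {x y z : K} {C : ℝ} (hxy : ‖x - y‖ ≤ C) (hyz : ‖y - z‖ ≤ C) :
    ‖x - z‖ ≤ C := by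
  simpa using norm_add_le_of_le hxy hyz

theorem norm_le_of_norm_sub_le {x y : K} {C : ℝ} (hxy : ‖x - y‖ ≤ C) (hy : ‖y‖ ≤ C) :
    ‖x‖ ≤ C := by
  simpa using norm_add_le_of_le hxy hy

theorem norm_eq_of_norm_sub_lt {x y : K} (h : ‖x - y‖ < ‖y‖) : ‖x‖ = ‖y‖ := by
  have := IsUltrametricDist.norm_add_eq_max_of_norm_ne_norm h.ne
  rwa [sub_add_cancel, max_eq_right h.le] at this

theorem norm_prod_sub_prod_le {ι : Type*} (s : Finset ι) {u v : ι → K} {C : ℝ} (hC : 0 ≤ C)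
    (hu : ∀ i ∈ s, ‖u i‖ ≤ 1) (hv : ∀ i ∈ s, ‖v i‖ ≤ 1) (huv : ∀ i ∈ s, ‖u i - v i‖ ≤ C) :
    ‖∏ i ∈ s, u i - ∏ i ∈ s, v i‖ ≤ C := by
  classical
  induction s using Finset.induction_on with
  | empty => simpa using hC
  | insert a s ha ih =>
    rw [Finset.prod_insert ha, Finset.prod_insert ha]
    have h1 : ‖∏ i ∈ s, v i‖ ≤ 1 := by
      rw [norm_prod]
      exact Finset.prod_le_one (fun _ _ => norm_nonneg _)
        fun i hi => hv i (Finset.mem_insert_of_mem hi)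
    have h2 := ih (fun i hi => hu i (Finset.mem_insert_of_mem hi))
      (fun i hi => hv i (Finset.mem_insert_of_mem hi))
      (fun i hi => huv i (Finset.mem_insert_of_mem hi))
    have h3 := huv a (Finset.mem_insert_self a s)
    have h4 := hu a (Finset.mem_insert_self a s)
    refine norm_sub_le_trans (y := u a * ∏ i ∈ s, v i) ?_ ?_
    · rw [← mul_sub, norm_mul]
      exact (mul_le_of_le_one_left (norm_nonneg _) h4).trans h2
    · rw [← sub_mul, norm_mul]
      exact (mul_le_of_le_one_right (norm_nonneg _) h1).trans h3

theorem norm_pow_sub_pow_le {x y : K} {C : ℝ} (n : ℕ) (hx : ‖x‖ ≤ 1) (hy : ‖y‖ ≤ 1)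
    (hxy : ‖x - y‖ ≤ C) : ‖x ^ n - y ^ n‖ ≤ C := by
  simpa using norm_prod_sub_prod_le (Finset.range n) ((norm_nonneg _).trans hxy)
    (fun _ _ => hx) (fun _ _ => hy) (fun _ _ => hxy)

theorem norm_sum_sub_sum_le {ι : Type*} (s : Finset ι) {u v : ι → K} {C : ℝ} (hC : 0 ≤ C)
    (huv : ∀ i ∈ s, ‖u i - v i‖ ≤ C) : ‖∑ i ∈ s, u i - ∑ i ∈ s, v i‖ ≤ C := by
  rw [← Finset.sum_sub_distrib]
  exact IsUltrametricDist.norm_sum_le_of_forall_le_of_nonneg hC huv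

theorem norm_pow_sub_one_le {x : K} {δ : ℝ} (n : ℕ) (hδ : δ ≤ 1) (hx : ‖x - 1‖ ≤ δ) :
    ‖x ^ n - 1‖ ≤ max ‖(n : K)‖ δ * δ := by
  have hx1 : ‖x‖ ≤ 1 := norm_le_of_norm_sub_le (hx.trans hδ) (by simp)
  have h : ‖∑ i ∈ Finset.range n, x ^ i - ∑ i ∈ Finset.range n, (1 : K)‖ ≤ δ :=
    norm_sum_sub_sum_le _ ((norm_nonneg _).trans hx) fun i _ => by
      simpa using norm_pow_sub_pow_le i hx1 (by simp) hx
  rw [← geom_sum_mul, norm_mul]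
  refine mul_le_mul ?_ hx (norm_nonneg _) ((norm_nonneg _).trans (le_max_left _ _))
  refine norm_le_of_norm_sub_le (y := (n : K)) ?_ (le_max_left _ _)
  refine le_trans ?_ (le_max_right _ _)
  simpa using h

section Displacement

variable {U : Set K} {g : K → K} {ε : ℝ}

theorem norm_iterate_sub_iterate_le (hg : Set.MapsTo g U U) (hε : ε ≤ 1)
    (h : ∀ z ∈ U, ∀ w ∈ U, ‖(g z - z) - (g w - w)‖ ≤ ε * ‖z - w‖) (n : ℕ) {z w : K}
    (hz : z ∈ U) (hw : w ∈ U) : ‖g^[n] z - g^[n] w‖ ≤ ‖z - w‖ := by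
  induction n with
  | zero => simp
  | succ n ih =>
    rw [Function.iterate_succ_apply', Function.iterate_succ_apply']
    have h1 := h _ (hg.iterate n hz) _ (hg.iterate n hw)
    have h2 := h1.trans (mul_le_of_le_one_left (norm_nonneg _) hε)
    have := norm_add_le_of_le (h2.trans ih) ih
    convert this using 2
    ring

theorem norm_iterate_displacement_sub_le (hg : Set.MapsTo g U U) (hε₀ : 0 ≤ ε) (hε : ε ≤ 1)
    (h : ∀ z ∈ U, ∀ w ∈ U, ‖(g z - z) - (g w - w)‖ ≤ ε * ‖z - w‖) (n : ℕ) {z w : K}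
    (hz : z ∈ U) (hw : w ∈ U) : ‖(g^[n] z - z) - (g^[n] w - w)‖ ≤ ε * ‖z - w‖ := by
  induction n with
  | zero => simp; positivity
  | succ n ih =>
    rw [Function.iterate_succ_apply', Function.iterate_succ_apply']
    have h1 := (h _ (hg.iterate n hz) _ (hg.iterate n hw)).trans
      (mul_le_mul_of_nonneg_left (norm_iterate_sub_iterate_le hg hε h n hz hw) hε₀)
    have := norm_add_le_of_le h1 ih
    convert this using 2
    ring

theorem norm_iterate_sub_self_le (hg : Set.MapsTo g U U) (hε : ε ≤ 1)
    (h : ∀ z ∈ U, ∀ w ∈ U, ‖(g z - z) - (g w - w)‖ ≤ ε * ‖z - w‖) (n : ℕ) {z : K}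
    (hz : z ∈ U) : ‖g^[n] z - z‖ ≤ ‖g z - z‖ := by
  induction n with
  | zero => simp
  | succ n ih =>
    rw [Function.iterate_succ_apply]
    exact norm_sub_le_trans (norm_iterate_sub_iterate_le hg hε h n (hg hz) hz) ih

/-- Along the orbit of `z` the map is nearly a translation: every step adds `g z - z` up to an error
of relative size `ε`, and ultrametrically these errors do not accumulate. -/
theorem norm_iterate_sub_self_sub_le (hg : Set.MapsTo g U U) (hε₀ : 0 ≤ ε) (hε : ε ≤ 1)
    (h : ∀ z ∈ U, ∀ w ∈ U, ‖(g z - z) - (g w - w)‖ ≤ ε * ‖z - w‖) (n : ℕ) {z : K}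
    (hz : z ∈ U) : ‖g^[n] z - z - n * (g z - z)‖ ≤ ε * ‖g z - z‖ := by
  induction n with
  | zero => simp; positivity
  | succ n ih =>
    rw [Function.iterate_succ_apply']
    have h1 := (h _ (hg.iterate n hz) _ hz).trans
      (mul_le_mul_of_nonneg_left (norm_iterate_sub_self_le hg hε h n hz) hε₀)
    have := norm_add_le_of_le h1 ih
    convert this using 2
    push_cast
    ring

/-- If the displacement `g - id` is sufficiently contracting, then all periodic points of `g`
are fixed points. -/
theorem apply_eq_self_of_iterate_eq_self (hε₀ : 0 ≤ ε) (hε : ε ≤ 1)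
    (hq : ∀ q : ℕ, q.Prime → ε < ‖(q : K)‖) (n : ℕ) (hn : n ≠ 0) :
    ∀ g : K → K, Set.MapsTo g U U →
      (∀ z ∈ U, ∀ w ∈ U, ‖(g z - z) - (g w - w)‖ ≤ ε * ‖z - w‖) →
      ∀ x ∈ U, g^[n] x = x → g x = x := by
  -- Multiplicative induction reduces to prime periods. The map is quantified inside because `g^[a]`
  -- inherits the displacement bound.
  induction n using Nat.recOnMul with
  | zero => exact absurd rfl hn
  | one => intro g _ _ x _ hx; simpa using hx
  | prime q hqp =>
    intro g hg h x hx hqx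
    -- With `g^[q] x = x` this becomes |q|·|g x - x| ≤ ε·|g x - x|.
    have h1 := norm_iterate_sub_self_sub_le hg hε₀ hε h q hx
    rw [hqx, sub_self, zero_sub, norm_neg, norm_mul] at h1
    by_contra hne
    have h2 : 0 < ‖g x - x‖ := norm_pos_iff.2 (sub_ne_zero.2 hne)
    exact absurd (le_of_mul_le_mul_right h1 h2) (not_le.2 (hq q hqp))
  | mul a b iha ihb =>
    intro g hg h x hx hab
    rw [Function.iterate_mul] at hab
    refine iha (left_ne_zero_of_mul hn) g hg h x hx ?_
    exact ihb (right_ne_zero_of_mul hn) _ (hg.iterate a)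
      (fun z hz w hw => norm_iterate_displacement_sub_le hg hε₀ hε h a hz hw) x hx hab

end Displacement

namespace NearId

variable {U : Set K} {g : K → K} {σ δ : ℝ}

/-- The displacement of the iterate is n(g z - z) up to a factor `δ`. Its slope is a product of
slopes along orbits that stay within `σ` of their start, hence is `σ`-close to Φ^n, and Φ^n - 1 = (Φ
- 1)(1 + ... + Φ^(n-1)). -/
theorem iterate (h : NearId U g σ δ) (hδ₀ : 0 ≤ δ) (hδ : δ ≤ 1) (n : ℕ) :
    NearId U g^[n] (max ‖(n : K)‖ δ * σ) (max (max ‖(n : K)‖ δ * δ) σ) := by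
  have hL := h.norm_displacement_sub_le
  obtain ⟨h1, h2, Φ, h3, h4, h5⟩ := h
  have hΦ1 : ∀ z ∈ U, ∀ w ∈ U, ‖Φ z w‖ ≤ 1 := fun z hz w hw =>
    norm_le_of_norm_sub_le ((h4 z hz w hw).trans hδ) (by simp)
  have hmem : ∀ (i : ℕ) z, z ∈ U → g^[i] z ∈ U := fun i z hz => h1.iterate i hz
  refine ⟨h1.iterate n, fun z hz => ?_,
    fun z w => ∏ i ∈ Finset.range n, Φ (g^[i] z) (g^[i] w), ?_, ?_, ?_⟩
  · refine norm_le_of_norm_sub_le (y := n * (g z - z)) ?_ ?_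
    · refine (norm_iterate_sub_self_sub_le h1 hδ₀ hδ hL n hz).trans ?_
      exact mul_le_mul (le_max_right _ _) (h2 z hz) (norm_nonneg _) (hδ₀.trans (le_max_right _ _))
    · rw [norm_mul]
      exact mul_le_mul (le_max_left _ _) (h2 z hz) (norm_nonneg _) (hδ₀.trans (le_max_right _ _))
  · intro z hz w hw
    clear h2 h4 h5
    induction n with
    | zero => simp
    | succ n ih =>
      beta_reduce at ih ⊢
      rw [Function.iterate_succ_apply', Function.iterate_succ_apply',
        h3 _ (hmem n z hz) _ (hmem n w hw), ih, Finset.prod_range_succ, mul_assoc]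
  · intro z hz w hw
    refine norm_sub_le_trans (y := Φ z w ^ n) ?_ ?_
    · refine le_trans ?_ (le_max_right _ _)
      have := norm_prod_sub_prod_le (Finset.range n) (u := fun i => Φ (g^[i] z) (g^[i] w))
        (v := fun _ => Φ z w) ((norm_nonneg _).trans (h2 z hz))
        (fun i _ => hΦ1 _ (hmem i z hz) _ (hmem i w hw)) (fun _ _ => hΦ1 z hz w hw)
        (fun i _ => h5 σ _ (hmem i z hz) _ (hmem i w hw) z hz w hw
          ((norm_iterate_sub_self_le h1 hδ hL i hz).trans (h2 z hz))
          ((norm_iterate_sub_self_le h1 hδ hL i hw).trans (h2 w hw)))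
      simpa using this
    · exact (norm_pow_sub_one_le n hδ (h4 z hz w hw)).trans (le_max_left _ _)
  · intro C z hz w hw z' hz' w' hw' hzz hww
    refine norm_prod_sub_prod_le _ ((norm_nonneg _).trans hzz)
      (fun i _ => hΦ1 _ (hmem i z hz) _ (hmem i w hw))
      (fun i _ => hΦ1 _ (hmem i z' hz') _ (hmem i w' hw')) fun i _ => ?_
    exact h5 C _ (hmem i z hz) _ (hmem i w hw) _ (hmem i z' hz') _ (hmem i w' hw')
      ((norm_iterate_sub_iterate_le h1 hδ hL i hz hz').trans hzz)
      ((norm_iterate_sub_iterate_le h1 hδ hL i hw hw').trans hww)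

/-- Each p-th iterate gains a factor `ρ` in displacement. The slope error cannot drop below the
previous displacement, so its exponent lags by one. -/
theorem iterate_pow {p : ℕ} {ρ : ℝ} (hρ : ρ ≤ 1) (hp : ‖(p : K)‖ ≤ ρ) (h : NearId U g ρ ρ)
    (j : ℕ) : NearId U g^[p ^ (j + 1)] (ρ ^ (j + 2)) (ρ ^ (j + 1)) := by
  have hρ₀ : 0 ≤ ρ := (norm_nonneg _).trans hp
  induction j with
  | zero =>
    have := h.iterate hρ₀ hρ p
    rw [max_eq_right hp] at this
    rw [zero_add, pow_one]
    refine this.mono (le_of_eq (by ring)) ?_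
    rw [pow_one]
    exact max_le (mul_le_of_le_one_left hρ₀ hρ) le_rfl
  | succ j ih =>
    have hpow : ρ ^ (j + 1) ≤ ρ := pow_le_of_le_one hρ₀ hρ (Nat.succ_ne_zero j)
    have := ih.iterate (pow_nonneg hρ₀ _) (pow_le_one₀ hρ₀ hρ) p
    rw [← Function.iterate_mul, ← pow_succ] at this
    have hmax := max_le hp hpow
    refine this.mono ?_ (max_le ?_ le_rfl)
    · calc _ ≤ ρ * ρ ^ (j + 2) := mul_le_mul_of_nonneg_right hmax (pow_nonneg hρ₀ _)
        _ = ρ ^ (j + 1 + 2) := by ring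
    · calc _ ≤ ρ * ρ ^ (j + 1) := mul_le_mul_of_nonneg_right hmax (pow_nonneg hρ₀ _)
        _ = ρ ^ (j + 1 + 1) := by ring

end NearId

end Ultrametric

end RatDyn

namespace RatDyn

/-! ### Finiteness of the residue orbit. -/

section Residue

open Polynomial

theorem norm_sum_lt_one {K ι : Type*} [NormedField K] [IsUltrametricDist K] (s : Finset ι)
    {f : ι → K} (hf : ∀ i ∈ s, ‖f i‖ < 1) : ‖∑ i ∈ s, f i‖ < 1 :=
  Finset.sum_induction f (fun x => ‖x‖ < 1)
    (fun _ _ hx hy => (IsUltrametricDist.norm_add_le_max _ _).trans_lt (max_lt hx hy))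
    (by simp) hf

/-- Every element of the closed unit disk of `ℂ_[p]` is algebraic over `𝔽_p` modulo the open
unit disk. -/
theorem exists_monic_norm_aeval_lt_one (p : ℕ) [Fact p.Prime] {a : PadicComplex p}
    (ha : ‖a‖ ≤ 1) :
    ∃ Q : ℤ[X], Q.Monic ∧ ‖Q.eval₂ (Int.castRingHom (PadicComplex p)) a‖ < 1 := by
  obtain ⟨b, hab⟩ : ∃ b : PadicAlgCl p, ‖a - (b : PadicComplex p)‖ < 1 := by
    obtain ⟨b, hb⟩ := UniformSpace.Completion.denseRange_coe.exists_dist_lt a one_pos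
    exact ⟨b, by rwa [← dist_eq_norm]⟩
  set B : PadicComplex p := (b : PadicComplex p) with hB
  have hB1 : ‖B‖ ≤ 1 := norm_le_of_norm_sub_le (by rw [norm_sub_rev]; exact hab.le) ha
  have hb : ‖b‖ ≤ 1 := by rwa [← PadicComplex.norm_extends p b]
  have hint : IsIntegral ℚ_[p] b := Algebra.IsIntegral.isIntegral b
  set P := minpoly ℚ_[p] b with hP
  have hPm : P.Monic := minpoly.monic hint
  -- The norm on `PadicAlgCl p` is the spectral norm, so |b| ≤ 1 forces an integral minimal
  -- polynomial, whose coefficients are integers modulo p.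
  have hcoeff : ∀ n, ‖P.coeff n‖ ≤ 1 :=
    (spectralValue_le_one_iff hPm).1 hb
  have hq : ∀ n, ∃ q : ℤ, ‖(q : ℚ_[p]) - P.coeff n‖ < 1 := by
    intro n
    obtain ⟨y, hy⟩ : ∃ y : ℤ_[p], (y : ℚ_[p]) = P.coeff n := ⟨⟨_, hcoeff n⟩, rfl⟩
    obtain ⟨m, -, hm⟩ := PadicInt.exists_mem_range y
    rw [IsLocalRing.mem_maximalIdeal, PadicInt.mem_nonunits, PadicInt.norm_def,
      PadicInt.coe_sub, PadicInt.coe_natCast, hy] at hm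
    exact ⟨m, by rwa [norm_sub_rev, Int.cast_natCast]⟩
  choose q hq using hq
  have hPB : aeval B P = 0 := by
    have : aeval (algebraMap (PadicAlgCl p) (PadicComplex p) b) P = 0 := by
      rw [aeval_algebraMap_apply, minpoly.aeval, map_zero]
    exact this
  have hpow : ∀ i : ℕ, ‖a ^ i - B ^ i‖ < 1 := fun i =>
    (norm_pow_sub_pow_le i ha hB1 le_rfl).trans_lt hab
  have hterm : ∀ i, ‖(q i : PadicComplex p) * a ^ i -
      algebraMap ℚ_[p] (PadicComplex p) (P.coeff i) * B ^ i‖ < 1 := by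
    intro i
    have h : (q i : PadicComplex p) * a ^ i -
        algebraMap ℚ_[p] (PadicComplex p) (P.coeff i) * B ^ i =
        (q i : PadicComplex p) * (a ^ i - B ^ i) +
          algebraMap ℚ_[p] (PadicComplex p) ((q i : ℚ_[p]) - P.coeff i) * B ^ i := by
      rw [map_sub, map_intCast]
      ring
    rw [h]
    refine (IsUltrametricDist.norm_add_le_max _ _).trans_lt (max_lt ?_ ?_) <;> rw [norm_mul]
    · exact mul_lt_one_of_nonneg_of_lt_one_right (IsUltrametricDist.norm_intCast_le_one _ _)
        (norm_nonneg _) (hpow i)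
    · refine mul_lt_one_of_nonneg_of_lt_one_left (norm_nonneg _) ?_ ?_
      · rw [norm_algebraMap']
        exact hq i
      · rw [norm_pow]
        exact pow_le_one₀ (norm_nonneg _) hB1
  refine ⟨X ^ P.natDegree + ∑ i ∈ Finset.range P.natDegree, C (q i) * X ^ i,
    monic_X_pow_add ((degree_sum_fin_lt (n := P.natDegree) fun i => q i).trans_eq' ?_), ?_⟩
  · rw [Finset.sum_range]
  · have hsub : (X ^ P.natDegree + ∑ i ∈ Finset.range P.natDegree, C (q i) * X ^ i).eval₂
        (Int.castRingHom (PadicComplex p)) a =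
        (a ^ P.natDegree - B ^ P.natDegree) + ∑ i ∈ Finset.range P.natDegree,
          ((q i : PadicComplex p) * a ^ i -
            algebraMap ℚ_[p] (PadicComplex p) (P.coeff i) * B ^ i) := by
      rw [hPm.as_sum] at hPB
      simp only [map_add, map_sum, map_mul, map_pow, aeval_X, aeval_C] at hPB
      simp only [eval₂_add, eval₂_finsetSum, eval₂_mul, eval₂_pow, eval₂_X, eval₂_C]
      rw [Finset.sum_sub_distrib]
      simp only [eq_intCast]
      linear_combination hPB
    rw [hsub]
    exact (IsUltrametricDist.norm_add_le_max _ _).trans_lt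
      (max_lt (hpow _) (norm_sum_lt_one _ fun i _ => hterm i))

theorem norm_aeval_int_le_one {K : Type*} [NormedField K] [IsUltrametricDist K] {a : K}
    (ha : ‖a‖ ≤ 1) (R : ℤ[X]) : ‖aeval a R‖ ≤ 1 := by
  rw [aeval_eq_sum_range]
  refine IsUltrametricDist.norm_sum_le_of_forall_le_of_nonneg zero_le_one fun i _ => ?_
  rw [zsmul_eq_mul, norm_mul, norm_pow]
  exact mul_le_one₀ (IsUltrametricDist.norm_intCast_le_one K _) (by positivity)
    (pow_le_one₀ (norm_nonneg _) ha)

/-- The residue of R(a) depends only on `R` modulo `Q` and p, i.e. on an element of the finite ring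
𝔽_p[X]/(Q). Pigeonhole applies to both sequences at once. -/
theorem exists_lt_norm_sub_lt_one {K : Type*} [NormedField K] [IsUltrametricDist K] {p : ℕ}
    (hp0 : p ≠ 0) (hp : ‖(p : K)‖ < 1) {a : K} (ha : ‖a‖ ≤ 1)
    {Q : ℤ[X]} (hQ : Q.Monic) (hQa : ‖aeval a Q‖ < 1) (u v : ℕ → ℤ[X]) :
    ∃ m n, m < n ∧ ‖aeval a (u n) - aeval a (u m)‖ < 1 ∧ ‖aeval a (v n) - aeval a (v m)‖ < 1 := by
  have hint := norm_aeval_int_le_one ha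
  let F : ℤ[X] → Fin Q.natDegree → ZMod p := fun R i => ((R %ₘ Q).coeff i : ZMod p)
  have hF : ∀ R S, F R = F S → ‖aeval a R - aeval a S‖ < 1 := by
    intro R S hRS
    have hdvd : C (p : ℤ) ∣ (R - S) %ₘ Q := by
      rw [C_dvd_iff_dvd_coeff]
      intro i
      rw [sub_modByMonic, coeff_sub]
      by_cases hi : i < Q.natDegree
      · have := congrFun hRS ⟨i, hi⟩
        rw [← ZMod.intCast_zmod_eq_zero_iff_dvd] 
        simpa [F, sub_eq_zero] using this
      · have h0 : ∀ T : ℤ[X], (T %ₘ Q).coeff i = 0 := fun T =>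
          coeff_eq_zero_of_degree_lt ((degree_modByMonic_lt T hQ).trans_le
            (degree_le_of_natDegree_le (not_lt.1 hi)))
        simp [h0]
    obtain ⟨T, hT⟩ := hdvd
    rw [← map_sub, ← modByMonic_add_div (R - S) Q, hT, map_add, map_mul, map_mul]
    refine (IsUltrametricDist.norm_add_le_max _ _).trans_lt (max_lt ?_ ?_)
    · rw [norm_mul]
      refine mul_lt_one_of_nonneg_of_lt_one_left (norm_nonneg _) ?_ (hint T)
      simpa using hp
    · rw [norm_mul]
      exact mul_lt_one_of_nonneg_of_lt_one_left (norm_nonneg _) hQa (hint _)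
  have : NeZero p := ⟨hp0⟩
  obtain ⟨m, n, hmn, h⟩ := Finite.exists_ne_map_eq_of_infinite fun n => (F (u n), F (v n))
  rw [Prod.mk.injEq] at h
  rcases lt_or_gt_of_ne hmn with hlt | hlt
  · exact ⟨m, n, hlt, hF _ _ h.1.symm, hF _ _ h.2.symm⟩
  · exact ⟨n, m, hlt, hF _ _ h.1, hF _ _ h.2⟩

end Residue

end RatDyn

namespace RatDyn

/-! ### The critical orbit: algebra, norms and escape. -/

section CritOrbit

/-- The `n`-th point of the orbit of `0` under `z ↦ z ^ d + c`. -/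
def critOrbit {R : Type*} [CommRing R] (d : ℕ) (c : R) (n : ℕ) : R :=
  (fun z => z ^ d + c)^[n] 0

variable {R S : Type*} [CommRing R] [CommRing S]

theorem critOrbit_zero (d : ℕ) (c : R) : critOrbit d c 0 = 0 := rfl

theorem critOrbit_succ (d : ℕ) (c : R) (n : ℕ) :
    critOrbit d c (n + 1) = critOrbit d c n ^ d + c :=
  Function.iterate_succ_apply' _ _ _

theorem iterate_critOrbit (d : ℕ) (c : R) (k n : ℕ) :
    (fun z => z ^ d + c)^[k] (critOrbit d c n) = critOrbit d c (n + k) := by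
  rw [critOrbit, critOrbit, ← Function.iterate_add_apply, add_comm]

theorem map_critOrbit (φ : R →+* S) (d : ℕ) (c : R) (n : ℕ) :
    φ (critOrbit d c n) = critOrbit d (φ c) n := by
  induction n with
  | zero => simp [critOrbit_zero]
  | succ n ih => simp [critOrbit_succ, ih]

theorem aeval_critOrbit (d : ℕ) (c : R) (n : ℕ) :
    Polynomial.aeval c (critOrbit d (Polynomial.X : Polynomial ℤ) n) = critOrbit d c n := by
  have := map_critOrbit (Polynomial.aeval c : Polynomial ℤ →ₐ[ℤ] R).toRingHom d Polynomial.X n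
  simpa using this

theorem critOrbit_add_eq {d : ℕ} {c : R} {m n : ℕ} (h : critOrbit d c n = critOrbit d c m)
    (k : ℕ) : critOrbit d c (n + k) = critOrbit d c (m + k) := by
  rw [← iterate_critOrbit, ← iterate_critOrbit, h]

theorem critOrbit_add_mul_eq {d : ℕ} {c : R} {m l : ℕ}
    (h : critOrbit d c (m + l) = critOrbit d c m) {k : ℕ} (hk : m ≤ k) (j : ℕ) :
    critOrbit d c (k + j * l) = critOrbit d c k := by
  obtain ⟨k, rfl⟩ := Nat.exists_eq_add_of_le hk
  induction j with
  | zero => simp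
  | succ j ih =>
    have := critOrbit_add_eq h (k + j * l)
    rw [← ih]
    convert this using 2 <;> ring

/-- The divided difference of `z ↦ z ^ d + c`. -/
def powSlope (d : ℕ) (z w : R) : R :=
  ∑ i ∈ Finset.range d, z ^ i * w ^ (d - 1 - i)

theorem pow_add_sub_pow_add (d : ℕ) (c z w : R) :
    (z ^ d + c) - (w ^ d + c) = (z - w) * powSlope d z w := by
  rw [powSlope, mul_comm, geom_sum₂_mul]
  ring

theorem powSlope_self (d : ℕ) (z : R) : powSlope d z z = d * z ^ (d - 1) := by
  rw [powSlope]
  exact geom_sum₂_self z d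

theorem iterate_sub_iterate (d : ℕ) (c : R) (n : ℕ) (z w : R) :
    (fun z => z ^ d + c)^[n] z - (fun z => z ^ d + c)^[n] w =
      (z - w) * ∏ i ∈ Finset.range n,
        powSlope d ((fun z => z ^ d + c)^[i] z) ((fun z => z ^ d + c)^[i] w) := by
  induction n with
  | zero => simp
  | succ n ih =>
    rw [Function.iterate_succ_apply', Function.iterate_succ_apply', pow_add_sub_pow_add, ih,
      Finset.prod_range_succ, mul_assoc]

theorem norm_critOrbit_succ_sub_eq {K : Type*} [NormedField K] (d : ℕ) (c : K) (m n : ℕ) :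
    ‖critOrbit d c (m + 1) - critOrbit d c (n + 1)‖ =
      ‖critOrbit d c m - critOrbit d c n‖ * ‖powSlope d (critOrbit d c m) (critOrbit d c n)‖ := by
  rw [critOrbit_succ, critOrbit_succ, pow_add_sub_pow_add, norm_mul]

end CritOrbit

section Norm

variable {K : Type*} [NormedField K] [IsUltrametricDist K] {d : ℕ}

theorem norm_powSlope_sub_le {z w z' w' : K} {C : ℝ} (hz : ‖z‖ ≤ 1) (hw : ‖w‖ ≤ 1)
    (hz' : ‖z'‖ ≤ 1) (hw' : ‖w'‖ ≤ 1) (hzz : ‖z - z'‖ ≤ C) (hww : ‖w - w'‖ ≤ C) :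
    ‖powSlope d z w - powSlope d z' w'‖ ≤ C := by
  refine norm_sum_sub_sum_le _ ((norm_nonneg _).trans hzz) fun i _ => ?_
  refine norm_sub_le_trans (y := z ^ i * w' ^ (d - 1 - i)) ?_ ?_
  · rw [← mul_sub, norm_mul]
    refine (mul_le_of_le_one_left (norm_nonneg _) ?_).trans (norm_pow_sub_pow_le _ hw hw' hww)
    rw [norm_pow]; exact pow_le_one₀ (norm_nonneg _) hz
  · rw [← sub_mul, norm_mul]
    refine (mul_le_of_le_one_right (norm_nonneg _) ?_).trans (norm_pow_sub_pow_le _ hz hz' hzz)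
    rw [norm_pow]; exact pow_le_one₀ (norm_nonneg _) hw'

theorem norm_powSlope_le_one {z w : K} (hz : ‖z‖ ≤ 1) (hw : ‖w‖ ≤ 1) :
    ‖powSlope d z w‖ ≤ 1 := by
  refine IsUltrametricDist.norm_sum_le_of_forall_le_of_nonneg zero_le_one fun i _ => ?_
  rw [norm_mul, norm_pow, norm_pow]
  exact mul_le_one₀ (pow_le_one₀ (norm_nonneg _) hz) (by positivity)
    (pow_le_one₀ (norm_nonneg _) hw)

theorem norm_powSlope_le (hd : 2 ≤ d) {z w : K} {C : ℝ} (hC : C ≤ 1) (hz : ‖z‖ ≤ C)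
    (hw : ‖w‖ ≤ C) : ‖powSlope d z w‖ ≤ C := by
  have hC₀ := (norm_nonneg _).trans hz
  refine IsUltrametricDist.norm_sum_le_of_forall_le_of_nonneg hC₀ fun i hi => ?_
  rw [norm_mul, norm_pow, norm_pow]
  calc ‖z‖ ^ i * ‖w‖ ^ (d - 1 - i) ≤ C ^ i * C ^ (d - 1 - i) := by gcongr
    _ = C ^ (d - 1) := by
      rw [← pow_add]; congr 1; have := Finset.mem_range.1 hi; omega
    _ ≤ C := pow_le_of_le_one hC₀ hC (by omega)

/-- Distinct `d`-th roots of the same element are not too close. -/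
theorem norm_natCast_mul_norm_le_of_pow_eq (hd : d ≠ 0) {z w : K} (hne : w ≠ z)
    (h : w ^ d = z ^ d) : ‖(d : K)‖ * ‖z‖ ≤ ‖w - z‖ := by
  have hz : z ≠ 0 := by
    rintro rfl
    rw [zero_pow hd] at h
    exact hne (pow_eq_zero_iff hd |>.1 h)
  set ζ := w / z with hζ
  have hζd : ζ ^ d = 1 := by rw [hζ, div_pow, h, div_self (pow_ne_zero _ hz)]
  have hζ1 : ζ ≠ 1 := fun h1 => hne ((div_eq_one_iff_eq hz).1 h1)
  have hnorm : ‖ζ‖ = 1 := by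
    rw [← pow_eq_one_iff_of_nonneg (norm_nonneg _) hd, ← norm_pow, hζd, norm_one]
  have hsum : ∑ i ∈ Finset.range d, ζ ^ i = 0 := by
    have := geom_sum_mul ζ d
    rw [hζd, sub_self] at this
    exact (mul_eq_zero.1 this).resolve_right (sub_ne_zero.2 hζ1)
  -- The powers of `ζ` sum to 0, so the left side is |d|.
  have hle : ‖∑ i ∈ Finset.range d, (1 : K) - ∑ i ∈ Finset.range d, ζ ^ i‖ ≤ ‖ζ - 1‖ :=
    norm_sum_sub_sum_le _ (norm_nonneg _) fun i _ => by
      rw [norm_sub_rev]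
      simpa using norm_pow_sub_pow_le i hnorm.le (by simp) (le_refl ‖ζ - 1‖)
  rw [hsum] at hle
  have hw : w - z = (ζ - 1) * z := by rw [sub_mul, hζ, div_mul_cancel₀ _ hz, one_mul]
  rw [hw, norm_mul]
  refine mul_le_mul_of_nonneg_right ?_ (norm_nonneg _)
  simpa using hle

/-- Once |z| ≥ |c| > 1, the term z^d strictly dominates c. The second conjunct keeps the induction
going. -/
theorem norm_critOrbit_lt_succ (hd : 2 ≤ d) {c : K} (hc : 1 < ‖c‖) (n : ℕ) :
    ‖critOrbit d c n‖ < ‖critOrbit d c (n + 1)‖ ∧ ‖c‖ ≤ ‖critOrbit d c (n + 1)‖ := by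
  induction n with
  | zero =>
    simp [critOrbit_succ, critOrbit_zero, zero_pow (show d ≠ 0 by omega)]
    intro h; simp [h] at hc; linarith
  | succ n ih =>
    set x := critOrbit d c (n + 1) with hx
    have h1 : 1 < ‖x‖ := hc.trans_le ih.2
    have h2 : ‖x‖ < ‖x ^ d‖ := by
      rw [norm_pow]
      exact lt_self_pow₀ h1 (by omega)
    have h3 : ‖critOrbit d c (n + 1 + 1)‖ = ‖x ^ d‖ := by
      rw [critOrbit_succ, IsUltrametricDist.norm_add_eq_max_of_norm_ne_norm
        (ih.2.trans_lt h2).ne', max_eq_left (ih.2.trans h2.le)]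
    rw [h3]
    exact ⟨h2, ih.2.trans h2.le⟩

theorem critOrbit_injective (hd : 2 ≤ d) {c : K} (hc : 1 < ‖c‖) :
    Function.Injective (critOrbit d c) := by
  have : StrictMono fun n => ‖critOrbit d c n‖ :=
    strictMono_nat_of_lt_succ fun n => (norm_critOrbit_lt_succ hd hc n).1
  exact fun m n h => this.injective (congrArg norm h)

section Integral

variable {c : K}

theorem norm_pow_add_le_one (hc : ‖c‖ ≤ 1) {z : K} (hz : ‖z‖ ≤ 1) : ‖z ^ d + c‖ ≤ 1 :=
  norm_add_le_of_le (by rw [norm_pow]; exact pow_le_one₀ (norm_nonneg _) hz) hc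

theorem norm_iterate_le_one (hc : ‖c‖ ≤ 1) (n : ℕ) {z : K} (hz : ‖z‖ ≤ 1) :
    ‖(fun z => z ^ d + c)^[n] z‖ ≤ 1 := by
  induction n with
  | zero => exact hz
  | succ n ih =>
    rw [Function.iterate_succ_apply']
    exact norm_pow_add_le_one hc ih

theorem norm_critOrbit_le_one (hc : ‖c‖ ≤ 1) (n : ℕ) : ‖critOrbit d c n‖ ≤ 1 :=
  norm_iterate_le_one hc n (by simp)

theorem norm_iterate_sub_iterate_le_of_integral (hc : ‖c‖ ≤ 1) (n : ℕ) {z w : K}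
    (hz : ‖z‖ ≤ 1) (hw : ‖w‖ ≤ 1) :
    ‖(fun z => z ^ d + c)^[n] z - (fun z => z ^ d + c)^[n] w‖ ≤ ‖z - w‖ := by
  rw [iterate_sub_iterate, norm_mul, norm_prod]
  refine mul_le_of_le_one_right (norm_nonneg _)
    (Finset.prod_le_one (fun _ _ => norm_nonneg _) fun i _ => ?_)
  exact norm_powSlope_le_one (norm_iterate_le_one hc i hz) (norm_iterate_le_one hc i hw)

theorem norm_critOrbit_add_sub_le (hc : ‖c‖ ≤ 1) (m n k : ℕ) :
    ‖critOrbit d c (m + k) - critOrbit d c (n + k)‖ ≤ ‖critOrbit d c m - critOrbit d c n‖ := by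
  rw [← iterate_critOrbit, ← iterate_critOrbit]
  exact norm_iterate_sub_iterate_le_of_integral hc k (norm_critOrbit_le_one hc m)
    (norm_critOrbit_le_one hc n)

theorem norm_critOrbit_sub_critOrbit_le {a : K} (hc : ‖c‖ ≤ 1) (ha : ‖a‖ ≤ 1) (n : ℕ) :
    ‖critOrbit d c n - critOrbit d a n‖ ≤ ‖c - a‖ := by
  induction n with
  | zero => simp [critOrbit_zero]
  | succ n ih =>
    rw [critOrbit_succ, critOrbit_succ, add_sub_add_comm]
    exact norm_add_le_of_le (norm_pow_sub_pow_le d (norm_critOrbit_le_one hc n)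
      (norm_critOrbit_le_one ha n) ih) le_rfl

end Integral

end Norm

end RatDyn

namespace RatDyn

/-! ### Uniform bounds in the attracting cases. -/

section Attracting

variable {K : Type*} [NormedField K] [IsUltrametricDist K] {d : ℕ}

theorem critOrbit_add_eq_of_le {R : Type*} [CommRing R] {c : R} {N t T : ℕ}
    (h : critOrbit d c (t + N) = critOrbit d c t) (hT : t ≤ T) :
    critOrbit d c (T + N) = critOrbit d c T := by
  simpa using critOrbit_add_mul_eq h hT 1

/-- A positive value would strictly shrink over one period, yet has to return to itself. -/
theorem exists_eq_zero_of_contracting {δ : ℕ → ℝ} {ρ : ℝ} {j₀ m l : ℕ} (hδ₀ : ∀ j, 0 ≤ δ j)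
    (hρ : ρ < 1) (hl : l ≠ 0) (hδ : ∀ j, j₀ ≤ j → δ (j + 1) ≤ ρ * δ j)
    (hper : ∀ j, m ≤ j → δ (j + l) = δ j) : ∃ j, δ j = 0 := by
  have hstep : ∀ j, j₀ ≤ j → ∀ i, δ (j + (i + 1)) ≤ ρ * δ j := by
    intro j hj i
    induction i with
    | zero => exact hδ j hj
    | succ i ih =>
      have h1 := hδ (j + (i + 1)) (by omega)
      have h2 : ρ * δ (j + (i + 1)) ≤ δ (j + (i + 1)) := mul_le_of_le_one_left (hδ₀ _) hρ.le
      exact (h1.trans h2).trans ih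
  obtain ⟨i, rfl⟩ := Nat.exists_eq_succ_of_ne_zero hl
  refine ⟨max j₀ m, ?_⟩
  have h1 := hstep (max j₀ m) (le_max_left _ _) i
  rw [hper _ (le_max_right _ _)] at h1
  nlinarith [hδ₀ (max j₀ m)]

/-- If the orbit of `0` approaches an attracting cycle faster than it approaches `0`,
then a preperiodic orbit enters the cycle at a bounded time. -/
theorem critOrbit_add_eq_of_attracting (hd : d ≠ 0) {c : K} {N T j₀ : ℕ} {ρ : ℝ} (hρ : ρ < 1)
    (hcontr : ∀ j, j₀ ≤ j → ‖critOrbit d c ((j + 1) * N + N) - critOrbit d c ((j + 1) * N)‖ ≤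
      ρ * ‖critOrbit d c (j * N + N) - critOrbit d c (j * N)‖)
    (hfar : ∀ n, T ≤ n →
      ‖critOrbit d c (n + N) - critOrbit d c n‖ < ‖(d : K)‖ * ‖critOrbit d c n‖)
    (hN : N ≠ 0) {m l : ℕ} (hl : l ≠ 0) (hper : critOrbit d c (m + l) = critOrbit d c m) :
    critOrbit d c (T + N) = critOrbit d c T := by
  have hex : ∃ t, critOrbit d c (t + N) = critOrbit d c t := by
    obtain ⟨j, hj⟩ := exists_eq_zero_of_contracting
      (δ := fun j => ‖critOrbit d c (j * N + N) - critOrbit d c (j * N)‖)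
      (m := m) (l := l) (fun _ => norm_nonneg _) hρ hl hcontr (by
        intro j hj
        have hjN : m ≤ j * N := hj.trans (Nat.le_mul_of_pos_right _ (Nat.pos_of_ne_zero hN))
        have h1 := critOrbit_add_mul_eq hper hjN N
        have h2 := critOrbit_add_mul_eq hper (hjN.trans (Nat.le_add_right _ N)) N
        rw [← h1, ← h2]
        congr 3 <;> ring)
    exact ⟨j * N, sub_eq_zero.1 (norm_eq_zero.1 hj)⟩
  classical
  have hspec := Nat.find_spec hex
  by_cases hle : Nat.find hex ≤ T
  · exact critOrbit_add_eq_of_le hspec hle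
  -- Just before the first landing time, the points at times `n` and `n + N` differ but have equal
  -- d-th powers, against `hfar`.
  · obtain ⟨n, hn⟩ : ∃ n, Nat.find hex = n + 1 := ⟨Nat.find hex - 1, by omega⟩
    have hne : critOrbit d c (n + N) ≠ critOrbit d c n := Nat.find_min hex (by omega)
    rw [hn, show n + 1 + N = n + N + 1 by ring, critOrbit_succ, critOrbit_succ,
      add_left_inj] at hspec
    exact absurd (norm_natCast_mul_norm_le_of_pow_eq hd hne hspec)
      (not_le.2 (hfar n (by omega)))

/-- Uniform bound on preperiods when `0` lies in a periodic residue class. -/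
theorem exists_bound_of_norm_critOrbit_lt_one (hd : 2 ≤ d) (hd0 : (d : K) ≠ 0) {a : K}
    (ha : ‖a‖ ≤ 1) {s : ℝ} (hs : s < 1) (hP : ∃ N, N ≠ 0 ∧ ‖critOrbit d a N‖ < 1) :
    ∃ T N, N ≠ 0 ∧ ∀ c : K, ‖c - a‖ ≤ s →
      (∃ m l, l ≠ 0 ∧ critOrbit d c (m + l) = critOrbit d c m) →
      critOrbit d c (T + N) = critOrbit d c T := by
  classical
  -- Minimality of the period makes the intermediate orbit points units.
  obtain ⟨hN, hNa⟩ := Nat.find_spec hP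
  have hmin : ∀ i, i ≠ 0 → i < Nat.find hP → ‖critOrbit d a i‖ = 1 := fun i hi hlt =>
    le_antisymm (norm_critOrbit_le_one ha i) (not_lt.1 fun h => Nat.find_min hP hlt ⟨hi, h⟩)
  set N := Nat.find hP
  set s' := max s ‖critOrbit d a N‖ with hs'
  have hs'1 : s' < 1 := max_lt hs hNa
  have hs'0 : 0 ≤ s' := (norm_nonneg _).trans (le_max_right _ _)
  obtain ⟨J, hJ⟩ := exists_pow_lt_of_lt_one (norm_pos_iff.2 hd0) hs'1
  refine ⟨(J + 1) * N, N, hN, ?_⟩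
  rintro c hca ⟨m, l, hl, hper⟩
  have hc : ‖c‖ ≤ 1 := norm_le_of_norm_sub_le (hca.trans hs.le) ha
  set z := critOrbit d c with hz
  by_cases hr : z N = 0
  · exact critOrbit_add_eq_of_le (t := 0) (by simpa [critOrbit_zero] using hr) (Nat.zero_le _)
  set r := ‖z N‖ with hrdef
  have hr0 : 0 < r := norm_pos_iff.2 hr
  have hrs : r ≤ s' := norm_le_of_norm_sub_le
    (((norm_critOrbit_sub_critOrbit_le hc ha N).trans hca).trans (le_max_left _ _))
    (le_max_right _ _)
  -- The first step, taken near the critical point, contracts by `s'`; the other `N - 1` steps do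
  -- not expand.
  have hstep : ∀ m n, ‖z m‖ ≤ s' → ‖z n‖ ≤ s' → ‖z (m + N) - z (n + N)‖ ≤ s' * ‖z m - z n‖ := by
    intro m n hm hn
    obtain ⟨k, hk⟩ := Nat.exists_eq_succ_of_ne_zero hN
    have h1 := norm_critOrbit_add_sub_le (d := d) hc (m + 1) (n + 1) k
    rw [norm_critOrbit_succ_sub_eq, mul_comm] at h1
    rw [hk, Nat.succ_eq_add_one, show m + (k + 1) = m + 1 + k by ring,
      show n + (k + 1) = n + 1 + k by ring]
    exact h1.trans (mul_le_mul_of_nonneg_right (norm_powSlope_le hd hs'1.le hm hn)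
      (norm_nonneg _))
  have hz0 : z 0 = 0 := rfl
  have hle : ∀ j, ‖z (j * N)‖ ≤ r := by
    intro j
    induction j with
    | zero => simpa [hz0] using hr0.le
    | succ j ih =>
      have h1 := hstep (j * N) 0 (ih.trans hrs) (by simpa [hz0] using hs'0)
      rw [hz0, sub_zero, zero_add] at h1
      rw [Nat.succ_mul]
      exact norm_le_of_norm_sub_le
        ((h1.trans (mul_le_of_le_one_left (norm_nonneg _) hs'1.le)).trans ih) le_rfl
  -- Every return to the residue class of 0 differs from `z N` by less than `r`. The returns thus
  -- keep a fixed distance from 0 while consecutive gaps shrink geometrically, as `hfar` needs.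
  have heq : ∀ j, ‖z ((j + 1) * N)‖ = r := by
    intro j
    have h1 := hstep (j * N) 0 ((hle j).trans hrs) (by simpa [hz0] using hs'0)
    rw [hz0, sub_zero, zero_add] at h1
    rw [Nat.succ_mul]
    refine norm_eq_of_norm_sub_lt (h1.trans_lt ?_)
    calc s' * ‖z (j * N)‖ ≤ s' * r := mul_le_mul_of_nonneg_left (hle j) hs'0
      _ < r := mul_lt_of_lt_one_left hr0 hs'1
  have hcontr : ∀ j, ‖z ((j + 1) * N + N) - z ((j + 1) * N)‖ ≤
      s' * ‖z (j * N + N) - z (j * N)‖ := by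
    intro j
    have hj : j * N + N = (j + 1) * N := by ring
    have := hstep ((j + 1) * N) (j * N) ((hle _).trans hrs) ((hle _).trans hrs)
    rwa [hj] at this ⊢
  have hδ : ∀ j, ‖z (j * N + N) - z (j * N)‖ ≤ s' ^ j * r := by
    intro j
    induction j with
    | zero => simp [hz0, hrdef]
    | succ j ih =>
      rw [pow_succ', mul_assoc]
      exact (hcontr j).trans (mul_le_mul_of_nonneg_left ih hs'0)
  refine critOrbit_add_eq_of_attracting (by omega) hs'1 (j₀ := 0) (fun j _ => hcontr j) ?_ hN hl
    hper
  intro n hn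
  obtain ⟨j, i, hi, rfl, hj⟩ : ∃ j i, i < N ∧ n = (j + 1) * N + i ∧ J ≤ j := by
    have hNpos := Nat.pos_of_ne_zero hN
    have h1 : J + 1 ≤ n / N := (Nat.le_div_iff_mul_le hNpos).2 hn
    refine ⟨n / N - 1, n % N, Nat.mod_lt _ hNpos, ?_, by omega⟩
    rw [Nat.sub_add_cancel (by omega), mul_comm]
    exact (Nat.div_add_mod n N).symm
  have hpow : s' ^ (j + 1) < ‖(d : K)‖ :=
    (pow_le_pow_of_le_one hs'0 hs'1.le (by omega)).trans_lt hJ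
  have hδn : ‖z ((j + 1) * N + i + N) - z ((j + 1) * N + i)‖ ≤ s' ^ (j + 1) * r := by
    rw [add_right_comm]
    exact (norm_critOrbit_add_sub_le hc _ _ i).trans (hδ (j + 1))
  refine hδn.trans_lt ?_
  rcases Nat.eq_zero_or_pos i with rfl | hipos
  · rw [add_zero]
    change _ < _ * ‖z _‖
    rw [heq]
    exact mul_lt_mul_of_pos_right hpow hr0
  · have h1 : ‖z ((j + 1) * N + i) - critOrbit d a i‖ ≤ s' := by
      refine norm_sub_le_trans (y := z i) ?_
        (((norm_critOrbit_sub_critOrbit_le hc ha i).trans hca).trans (le_max_left _ _))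
      have := norm_critOrbit_add_sub_le (d := d) hc ((j + 1) * N) 0 i
      rw [zero_add, critOrbit_zero, sub_zero] at this
      exact this.trans ((hle _).trans hrs)
    have h2 : ‖z ((j + 1) * N + i)‖ = 1 := by
      rw [← hmin i hipos.ne' hi]
      refine norm_eq_of_norm_sub_lt ?_
      rw [hmin i hipos.ne' hi]
      exact h1.trans_lt hs'1
    change _ < _ * ‖z _‖
    rw [h2, mul_one]
    exact (mul_le_of_le_one_right (pow_nonneg hs'0 _) (hrs.trans hs'1.le)).trans_lt hpow

/-- Uniform bound on preperiods when `z ↦ z ^ d` is inseparable modulo the maximal ideal and `0`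
is not in a periodic residue class. -/
theorem exists_bound_of_norm_natCast_lt_one (hd : 2 ≤ d) (hd0 : (d : K) ≠ 0)
    (hd1 : ‖(d : K)‖ < 1) {a : K} (ha : ‖a‖ ≤ 1) {s : ℝ} (hs : s < 1)
    (hunit : ∀ n, n ≠ 0 → ‖critOrbit d a n‖ = 1) {M N : ℕ} (hN : N ≠ 0)
    (hMN : ‖critOrbit d a (M + N) - critOrbit d a M‖ < 1) :
    ∃ T N, N ≠ 0 ∧ ∀ c : K, ‖c - a‖ ≤ s →
      (∃ m l, l ≠ 0 ∧ critOrbit d c (m + l) = critOrbit d c m) →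
      critOrbit d c (T + N) = critOrbit d c T := by
  set s' := max s ‖critOrbit d a (M + N) - critOrbit d a M‖ with hs'
  have hs'1 : s' < 1 := max_lt hs hMN
  set ρ := max s' ‖(d : K)‖ with hρ
  have hρ1 : ρ < 1 := max_lt hs'1 hd1
  have hρ0 : 0 ≤ ρ := (norm_nonneg _).trans (le_max_right _ _)
  obtain ⟨J, hJ⟩ := exists_pow_lt_of_lt_one (norm_pos_iff.2 hd0) hρ1
  -- The exponent `J` beats |d|; the extra 1 keeps later indices nonzero, so that those orbit points
  -- are units.
  refine ⟨M + (J + 1), N, hN, ?_⟩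
  rintro c hca ⟨m, l, hl, hper⟩
  have hc : ‖c‖ ≤ 1 := norm_le_of_norm_sub_le (hca.trans hs.le) ha
  have hclose : ∀ n, ‖critOrbit d c n - critOrbit d a n‖ ≤ s := fun n =>
    (norm_critOrbit_sub_critOrbit_le hc ha n).trans hca
  have hunit' : ∀ n, n ≠ 0 → ‖critOrbit d c n‖ = 1 := by
    intro n hn
    rw [← hunit n hn]
    refine norm_eq_of_norm_sub_lt ?_
    rw [hunit n hn]
    exact (hclose n).trans_lt hs
  have hM : ‖critOrbit d c (M + N) - critOrbit d c M‖ ≤ s' := by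
    refine norm_sub_le_trans ((hclose (M + N)).trans (le_max_left _ _)) ?_
    refine norm_sub_le_trans (le_max_right _ _) ?_
    rw [norm_sub_rev]
    exact (hclose M).trans (le_max_left _ _)
  have hk : ∀ k, M ≤ k → ‖critOrbit d c (k + N) - critOrbit d c k‖ ≤ s' := by
    intro k hk
    obtain ⟨i, rfl⟩ := Nat.exists_eq_add_of_le hk
    rw [add_right_comm]
    exact (norm_critOrbit_add_sub_le hc _ _ i).trans hM
  have hstep : ∀ k, M ≤ k → ‖critOrbit d c (k + 1 + N) - critOrbit d c (k + 1)‖ ≤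
      ρ * ‖critOrbit d c (k + N) - critOrbit d c k‖ := by
    intro k hMk
    rw [add_right_comm, norm_critOrbit_succ_sub_eq, mul_comm]
    refine mul_le_mul_of_nonneg_right ?_ (norm_nonneg _)
    have hk1 := norm_critOrbit_le_one (d := d) hc k
    have hk2 := norm_critOrbit_le_one (d := d) hc (k + N)
    -- On nearby points the slope is close to the derivative d·z^(d-1), of norm at most |d| < 1.
    refine norm_le_of_norm_sub_le (y := powSlope d (critOrbit d c k) (critOrbit d c k)) ?_ ?_
    · exact (norm_powSlope_sub_le hk2 hk1 hk1 hk1 (hk k hMk)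
        (by simpa using (norm_nonneg _).trans hM)).trans (le_max_left _ _)
    · rw [powSlope_self, norm_mul, norm_pow]
      exact (mul_le_of_le_one_right (norm_nonneg _)
        (pow_le_one₀ (norm_nonneg _) hk1)).trans (le_max_right _ _)
  have hδ : ∀ i, ‖critOrbit d c (M + i + N) - critOrbit d c (M + i)‖ ≤ ρ ^ i := by
    intro i
    induction i with
    | zero => simpa using hM.trans hs'1.le
    | succ i ih =>
      rw [pow_succ']
      exact (hstep (M + i) (Nat.le_add_right _ _)).trans (mul_le_mul_of_nonneg_left ih hρ0)
  refine critOrbit_add_eq_of_attracting (by omega) hρ1 (j₀ := M) ?_ ?_ hN hl hper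
  · intro j hj
    have hjN : M ≤ j * N := hj.trans (Nat.le_mul_of_pos_right _ (Nat.pos_of_ne_zero hN))
    refine le_trans ?_ (hstep (j * N) hjN)
    obtain ⟨k, hk⟩ := Nat.exists_eq_succ_of_ne_zero hN
    have hj : (j + 1) * N = j * N + 1 + k := by rw [add_one_mul]; omega
    rw [hj, add_right_comm _ k N]
    exact norm_critOrbit_add_sub_le hc (j * N + 1 + N) (j * N + 1) k
  · intro n hn
    obtain ⟨i, rfl⟩ := Nat.exists_eq_add_of_le (show M ≤ n by omega)
    rw [hunit' _ (by omega), mul_one]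
    exact ((hδ i).trans (pow_le_pow_of_le_one hρ0 hρ1.le (by omega))).trans_lt hJ

end Attracting

/-! ### Uniform bound in the indifferent case. -/

section Indifferent

variable {K : Type*} [NormedField K] [IsUltrametricDist K] {d : ℕ}

/-- The derivative at `c` of the `n`-th iterate of `z ↦ z ^ d + c`. -/
def critDeriv {R : Type*} [CommRing R] (d : ℕ) (c : R) (n : ℕ) : R :=
  ∏ i ∈ Finset.range n, (d * critOrbit d c (i + 1) ^ (d - 1))

theorem aeval_critDeriv {R : Type*} [CommRing R] (d : ℕ) (c : R) (n : ℕ) :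
    Polynomial.aeval c (critDeriv d (Polynomial.X : Polynomial ℤ) n) = critDeriv d c n := by
  simp [critDeriv, aeval_critOrbit]

theorem norm_natCast_eq_one_of_ne {p q : ℕ} (hp : p.Prime) (hq : q.Prime) (hpq : q ≠ p)
    (hp1 : ‖(p : K)‖ < 1) : ‖(q : K)‖ = 1 := by
  refine le_antisymm (IsUltrametricDist.norm_natCast_le_one K q) (not_lt.1 fun hq1 => ?_)
  have hcop : IsCoprime (q : ℤ) (p : ℤ) :=
    Nat.isCoprime_iff_coprime.2 ((Nat.coprime_primes hq hp).2 hpq)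
  obtain ⟨u, v, huv⟩ := hcop
  have h1 : (u : K) * q + v * p = 1 := by exact_mod_cast congrArg (Int.cast : ℤ → K) huv
  have h2 : ‖(u : K) * q + v * p‖ < 1 := by
    refine (IsUltrametricDist.norm_add_le_max _ _).trans_lt (max_lt ?_ ?_) <;> rw [norm_mul]
    · exact mul_lt_one_of_nonneg_of_lt_one_right (IsUltrametricDist.norm_intCast_le_one _ _)
        (norm_nonneg _) hq1
    · exact mul_lt_one_of_nonneg_of_lt_one_right (IsUltrametricDist.norm_intCast_le_one _ _)
        (norm_nonneg _) hp1
  rw [h1, norm_one] at h2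
  exact lt_irrefl _ h2

/-- Uniform bound on preperiods when the orbit of `0` is eventually in indifferent
residue classes. -/
theorem exists_bound_of_indifferent {p : ℕ} (hp : p.Prime) (hp1 : ‖(p : K)‖ < 1)
    (hp0 : (p : K) ≠ 0) (hd1 : ‖(d : K)‖ = 1) {a : K} (ha : ‖a‖ ≤ 1) {s : ℝ} (hs : s < 1)
    (hunit : ∀ n, n ≠ 0 → ‖critOrbit d a n‖ = 1) {M N : ℕ} (hN : N ≠ 0)
    (hMN : ‖critOrbit d a (M + N + 1) - critOrbit d a (M + 1)‖ < 1)
    (hMN' : ‖critDeriv d a (M + N) - critDeriv d a M‖ < 1) :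
    ∃ T N, N ≠ 0 ∧ ∀ c : K, ‖c - a‖ ≤ s →
      (∃ m l, l ≠ 0 ∧ critOrbit d c (m + l) = critOrbit d c m) →
      critOrbit d c (T + N) = critOrbit d c T := by
  set ρ := max (max s ‖(p : K)‖) (max ‖critOrbit d a (M + N + 1) - critOrbit d a (M + 1)‖
    ‖critDeriv d a (M + N) - critDeriv d a M‖) with hρ
  have hρ1 : ρ < 1 := max_lt (max_lt hs hp1) (max_lt hMN hMN')
  have hsρ : s ≤ ρ := (le_max_left _ _).trans (le_max_left _ _)
  have hpρ : ‖(p : K)‖ ≤ ρ := (le_max_right _ _).trans (le_max_left _ _)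
  have hρ0 : 0 ≤ ρ := (norm_nonneg _).trans hpρ
  obtain ⟨J, hJ⟩ := exists_pow_lt_of_lt_one (norm_pos_iff.2 hp0) hρ1
  have hJ' : ρ ^ (J + 1) < ‖(p : K)‖ :=
    (pow_le_pow_of_le_one hρ0 hρ1.le (Nat.le_succ J)).trans_lt hJ
  have hL : N * p ^ (J + 1) ≠ 0 := mul_ne_zero hN (pow_ne_zero _ hp.ne_zero)
  -- The preperiod starts at `M + 1` because `critDeriv` starts from the critical value, which
  -- avoids the zero derivative at 0. The factor p^(J+1) makes the slope error ρ^(J+1) < |p|.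
  refine ⟨M + 1, N * p ^ (J + 1), hL, ?_⟩
  rintro c hca ⟨m, l, hl, hper⟩
  have hc : ‖c‖ ≤ 1 := norm_le_of_norm_sub_le (hca.trans hs.le) ha
  have hint := norm_critOrbit_le_one (d := d) hc
  have hinta := norm_critOrbit_le_one (d := d) ha
  have hclose : ∀ n, ‖critOrbit d c n - critOrbit d a n‖ ≤ s := fun n =>
    (norm_critOrbit_sub_critOrbit_le hc ha n).trans hca
  have hunit' : ∀ n, n ≠ 0 → ‖critOrbit d c n‖ = 1 := by
    intro n hn
    rw [← hunit n hn]
    refine norm_eq_of_norm_sub_lt ?_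
    rw [hunit n hn]
    exact (hclose n).trans_lt hs
  have hclose' : ∀ n, ‖critDeriv d c n - critDeriv d a n‖ ≤ ρ := by
    have hfac : ∀ x : K, ‖x‖ ≤ 1 → ‖(d : K) * x ^ (d - 1)‖ ≤ 1 := by
      intro x hx
      rw [norm_mul, hd1, one_mul, norm_pow]
      exact pow_le_one₀ (norm_nonneg _) hx
    intro n
    refine norm_prod_sub_prod_le _ hρ0 (fun i _ => hfac _ (hint _))
      (fun i _ => hfac _ (hinta _)) fun i _ => ?_
    rw [← mul_sub, norm_mul, hd1, one_mul]
    exact norm_pow_sub_pow_le _ (hint _) (hinta _) ((hclose _).trans hsρ)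
  set f : K → K := fun z => z ^ d + c with hf
  set x := critOrbit d c (M + 1) with hx
  set U : Set K := {z | ‖z - x‖ ≤ ρ} with hU
  have hU1 : ∀ z ∈ U, ‖z‖ ≤ 1 := fun z hz =>
    norm_le_of_norm_sub_le (le_trans hz hρ1.le) (hint _)
  have hxU : x ∈ U := by simpa [hU] using hρ0
  have hxN : ‖f^[N] x - x‖ ≤ ρ := by
    rw [hx, hf, iterate_critOrbit, add_right_comm]
    refine norm_sub_le_trans ((hclose _).trans hsρ) ?_
    refine norm_sub_le_trans ((le_max_left _ _).trans (le_max_right _ _)) ?_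
    rw [norm_sub_rev]
    exact (hclose _).trans hsρ
  have hmaps : Set.MapsTo f^[N] U U := fun z hz =>
    norm_sub_le_trans ((norm_iterate_sub_iterate_le_of_integral hc N (hU1 z hz)
      (hU1 x hxU)).trans hz) hxN
  have hΦlip : ∀ C, ∀ z ∈ U, ∀ w ∈ U, ∀ z' ∈ U, ∀ w' ∈ U, ‖z - z'‖ ≤ C → ‖w - w'‖ ≤ C →
      ‖∏ i ∈ Finset.range N, powSlope d (f^[i] z) (f^[i] w) -
        ∏ i ∈ Finset.range N, powSlope d (f^[i] z') (f^[i] w')‖ ≤ C := by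
    intro C z hz w hw z' hz' w' hw' hzz hww
    have hi : ∀ (i : ℕ) y, y ∈ U → ‖f^[i] y‖ ≤ 1 := fun i y hy =>
      norm_iterate_le_one hc i (hU1 y hy)
    refine norm_prod_sub_prod_le _ ((norm_nonneg _).trans hzz)
      (fun i _ => norm_powSlope_le_one (hi i z hz) (hi i w hw))
      (fun i _ => norm_powSlope_le_one (hi i z' hz') (hi i w' hw')) fun i _ => ?_
    exact norm_powSlope_sub_le (hi i z hz) (hi i w hw) (hi i z' hz') (hi i w' hw')
      ((norm_iterate_sub_iterate_le_of_integral hc i (hU1 z hz) (hU1 z' hz')).trans hzz)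
      ((norm_iterate_sub_iterate_le_of_integral hc i (hU1 w hw) (hU1 w' hw')).trans hww)
  -- By the chain rule this product is the quotient of `critDeriv` at `M + N` and at `M`. Both are
  -- units with the same residue, so the quotient is near 1.
  have hΦx : ‖∏ i ∈ Finset.range N, powSlope d (f^[i] x) (f^[i] x) - 1‖ ≤ ρ := by
    have h1 : critDeriv d c (M + N) - critDeriv d c M =
        critDeriv d c M * (∏ i ∈ Finset.range N, powSlope d (f^[i] x) (f^[i] x) - 1) := by
      have h2 : ∀ i, powSlope d (f^[i] x) (f^[i] x) =
          d * critOrbit d c (M + i + 1) ^ (d - 1) := fun i => by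
        rw [powSlope_self, hx, hf, iterate_critOrbit, add_right_comm]
      simp only [h2]
      rw [critDeriv, Finset.prod_range_add, mul_sub, mul_one, critDeriv]
    have h3 : ‖critDeriv d c M‖ = 1 := by
      rw [critDeriv, norm_prod]
      refine Finset.prod_eq_one fun i _ => ?_
      rw [norm_mul, hd1, norm_pow, hunit' _ (Nat.succ_ne_zero i), one_pow, one_mul]
    have h4 : ‖critDeriv d c (M + N) - critDeriv d c M‖ ≤ ρ := by
      refine norm_sub_le_trans (hclose' _) ?_
      refine norm_sub_le_trans ((le_max_right _ _).trans (le_max_right _ _)) ?_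
      rw [norm_sub_rev]
      exact hclose' _
    rwa [h1, norm_mul, h3, one_mul] at h4
  have hnear : NearId U f^[N] ρ ρ := by
    refine ⟨hmaps, fun z hz => ?_, fun z w => ∏ i ∈ Finset.range N,
      powSlope d (f^[i] z) (f^[i] w), fun z _ w _ => iterate_sub_iterate d c N z w,
      fun z hz w hw => ?_, hΦlip⟩
    · refine norm_sub_le_trans (hmaps hz) ?_
      rw [norm_sub_rev]
      exact hz
    · exact norm_sub_le_trans (hΦlip ρ z hz w hw x hxU x hxU hz hw) hΦx
  have hG := hnear.iterate_pow hρ1.le hpρ J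
  rw [← Function.iterate_mul] at hG
  set L := N * p ^ (J + 1) with hLdef
  have hdisp := hG.norm_displacement_sub_le
  have hε0 : 0 ≤ ρ ^ (J + 1) := pow_nonneg hρ0 _
  have hε1 : ρ ^ (J + 1) < 1 := hJ'.trans hp1
  -- If two points had the same image, their displacements would differ by exactly their distance,
  -- but the displacement is a strict contraction.
  have hinj : Set.InjOn f^[L] U := by
    intro z hz w hw hzw
    have h1 := hdisp z hz w hw
    rw [hzw, sub_sub_sub_cancel_left, norm_sub_rev] at h1
    by_contra hne
    have h2 : 0 < ‖z - w‖ := norm_pos_iff.2 (sub_ne_zero.2 hne)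
    nlinarith
  have horb : ∀ j, (f^[L])^[j] x = critOrbit d c (M + 1 + L * j) := fun j => by
    rw [← Function.iterate_mul, hx, hf, iterate_critOrbit]
  have hyU : (f^[L])^[m] x ∈ U := hG.mapsTo.iterate m hxU
  have hyper : (f^[L])^[l] ((f^[L])^[m] x) = (f^[L])^[m] x := by
    rw [← Function.iterate_add_apply, horb, horb]
    have hm : m ≤ M + 1 + L * m :=
      (Nat.le_mul_of_pos_left m (Nat.pos_of_ne_zero hL)).trans (Nat.le_add_left _ _)
    rw [← critOrbit_add_mul_eq hper hm L]
    congr 1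
    ring
  -- Primes other than p have norm 1, so only |p| has to exceed the slope error.
  have hfix := apply_eq_self_of_iterate_eq_self hε0 hε1.le (fun q hq => by
    by_cases hqp : q = p
    · rwa [hqp]
    · rwa [norm_natCast_eq_one_of_ne hp hq hqp hp1]) l hl f^[L] hG.mapsTo hdisp _ hyU hyper
  -- The `m`-th iterate of `x` under `f^[L]` is fixed; injectivity on `U` cancels the `m`
  -- iterations, so `x` itself is fixed.
  rw [← Function.iterate_succ_apply' f^[L], Function.iterate_succ_apply] at hfix
  have := (hinj.iterate hG.mapsTo m) (hG.mapsTo hxU) hxU hfix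
  rwa [hx, hf, iterate_critOrbit] at this

end Indifferent

end RatDyn

namespace RatDyn

/-! ### From PCF to a preperiodic critical orbit. -/

section Unicritical

open Polynomial

variable {K : Type*} [Field K]

theorem unicritical_eq_algebraMap (d : ℕ) (c : K) :
    unicritical d c = algebraMap K[X] (RatFunc K) (X ^ d + C c) := by
  simp [unicritical]

theorem num_unicritical (d : ℕ) (c : K) : (unicritical d c).num = X ^ d + C c := by
  rw [unicritical_eq_algebraMap, RatFunc.num_algebraMap]

theorem denom_unicritical (d : ℕ) (c : K) : (unicritical d c).denom = 1 := by
  rw [unicritical_eq_algebraMap, RatFunc.denom_algebraMap]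

theorem toMap_unicritical_coe (d : ℕ) (c x : K) :
    toMap (unicritical d c) (x : OnePoint K) = ((x ^ d + c : K) : OnePoint K) := by
  change ratio _ _ = _
  simp [ratio, num_unicritical, denom_unicritical]

theorem isCriticalPoint_unicritical_zero {d : ℕ} (hd : 2 ≤ d) (c : K) :
    IsCriticalPoint (unicritical d c) ((0 : K) : OnePoint K) := by
  change 2 ≤ (fiberPoly _ (toMap _ _)).rootMultiplicity 0
  rw [toMap_unicritical_coe]
  change 2 ≤ ((unicritical d c).num - C _ * (unicritical d c).denom).rootMultiplicity 0
  rw [num_unicritical, denom_unicritical, zero_pow (by omega), zero_add, mul_one,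
    add_sub_cancel_right, rootMultiplicity_eq_natTrailingDegree']
  simpa using hd

theorem iterate_toMap_unicritical (d : ℕ) (c : K) (n : ℕ) :
    (toMap (unicritical d c))^[n] ((0 : K) : OnePoint K) = (critOrbit d c n : K) := by
  induction n with
  | zero => rfl
  | succ n ih => rw [Function.iterate_succ_apply', ih, toMap_unicritical_coe, critOrbit_succ]

theorem IsPCF.exists_critOrbit_eq [IsAlgClosed K] {d : ℕ} (hd : 2 ≤ d) {c : K}
    (h : IsPCF (unicritical d c)) :
    ∃ m l, l ≠ 0 ∧ critOrbit d c (m + l) = critOrbit d c m := by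
  obtain ⟨m, n, hmn, he⟩ := h _ (isCriticalPoint_unicritical_zero hd c)
  rw [iterate_toMap_unicritical, iterate_toMap_unicritical, OnePoint.coe_eq_coe] at he
  exact ⟨m, n - m, by omega, by rwa [Nat.add_sub_cancel' hmn.le]⟩

end Unicritical

/-! ### The uniform bound and finiteness of the parameters. -/

section Finiteness

open Polynomial

variable {K : Type*} [NormedField K] [IsUltrametricDist K] {d : ℕ}

/-- Preperiods and periods of preperiodic critical orbits are uniformly bounded on closed
disks of radius less than `1`. -/
theorem exists_bound {p : ℕ} (hp : p.Prime) (hp1 : ‖(p : K)‖ < 1) [CharZero K] (hd : 2 ≤ d)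
    {a : K} (ha : ‖a‖ ≤ 1) {Q : ℤ[X]} (hQ : Q.Monic)
    (hQa : ‖Q.eval₂ (Int.castRingHom K) a‖ < 1) {s : ℝ} (hs : s < 1) :
    ∃ T N, N ≠ 0 ∧ ∀ c : K, ‖c - a‖ ≤ s →
      (∃ m l, l ≠ 0 ∧ critOrbit d c (m + l) = critOrbit d c m) →
      critOrbit d c (T + N) = critOrbit d c T := by
  have hd0 : (d : K) ≠ 0 := Nat.cast_ne_zero.2 (by omega)
  by_cases hP : ∃ N, N ≠ 0 ∧ ‖critOrbit d a N‖ < 1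
  · exact exists_bound_of_norm_critOrbit_lt_one hd hd0 ha hs hP
  have hunit : ∀ n, n ≠ 0 → ‖critOrbit d a n‖ = 1 := fun n hn =>
    le_antisymm (norm_critOrbit_le_one ha n) (not_lt.1 fun h => hP ⟨n, hn, h⟩)
  -- Orbit point and multiplier must recur simultaneously, so that the return map has residue
  -- derivative 1 when |d| = 1.
  obtain ⟨M, n, hMn, h1, h2⟩ := exists_lt_norm_sub_lt_one hp.ne_zero hp1 ha hQ hQa
    (fun n => critOrbit d X (n + 1)) (fun n => critDeriv d X n)
  simp only [aeval_critOrbit, aeval_critDeriv] at h1 h2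
  obtain ⟨N, rfl⟩ := Nat.exists_eq_add_of_le hMn.le
  have hN : N ≠ 0 := by omega
  rcases (IsUltrametricDist.norm_natCast_le_one K d).lt_or_eq with hd1 | hd1
  · refine exists_bound_of_norm_natCast_lt_one hd hd0 hd1 ha hs hunit (M := M + 1) hN ?_
    rwa [add_right_comm]
  · exact exists_bound_of_indifferent hp hp1 (Nat.cast_ne_zero.2 hp.ne_zero) hd1 ha hs hunit hN
      h1 h2

/-- The parameter `b` has an infinite critical orbit, so it witnesses that the defining polynomial
in c is nonzero. -/
theorem finite_setOf_critOrbit_eq (hd : 2 ≤ d) {b : K} (hb : 1 < ‖b‖) {m n : ℕ} (hmn : m ≠ n) :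
    {c : K | critOrbit d c m = critOrbit d c n}.Finite := by
  set P : K[X] := critOrbit d X m - critOrbit d X n with hP
  have heval : ∀ c : K, P.eval c = critOrbit d c m - critOrbit d c n := fun c => by
    rw [hP, eval_sub, ← coe_evalRingHom, map_critOrbit, map_critOrbit, coe_evalRingHom, eval_X]
  have hP0 : P ≠ 0 := fun h => by
    have := heval b
    rw [h, eval_zero] at this
    exact hmn (critOrbit_injective hd hb (sub_eq_zero.1 this.symm))
  refine (P.finite_setOfPred_isRoot hP0).subset fun c hc => ?_
  change P.eval c = 0
  rw [heval, sub_eq_zero]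
  exact hc

end Finiteness

theorem norm_natCast_prime_padicComplex (p : ℕ) [Fact p.Prime] :
    ‖(p : PadicComplex p)‖ = (p : ℝ)⁻¹ := by
  rw [← map_natCast (algebraMap ℚ_[p] (PadicComplex p)) p, norm_algebraMap', Padic.norm_p]

end RatDyn

theorem theorem1p4 (p : ℕ) [Fact p.Prime] (d : ℕ) (hd : 2 ≤ d) :
    (∀ c : PadicComplex p, RatDyn.IsPCF (RatDyn.unicritical d c) → ‖c‖ ≤ 1) ∧
    (∀ a : PadicComplex p, ‖a‖ ≤ 1 → ∀ s : ℝ, 0 < s → s < 1 →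
      {c : PadicComplex p | c ∈ Metric.closedBall a s ∧
        RatDyn.IsPCF (RatDyn.unicritical d c)}.Finite) := by
  have hp : p.Prime := Fact.out
  have hp1 : ‖(p : PadicComplex p)‖ < 1 := by
    rw [RatDyn.norm_natCast_prime_padicComplex]
    exact inv_lt_one_of_one_lt₀ (by exact_mod_cast hp.one_lt)
  refine ⟨fun c hc => ?_, fun a ha s _ hs => ?_⟩
  · obtain ⟨m, l, hl, h⟩ := hc.exists_critOrbit_eq hd
    by_contra hlt
    have := RatDyn.critOrbit_injective hd (not_le.1 hlt) h
    omega
  · obtain ⟨Q, hQ, hQa⟩ := RatDyn.exists_monic_norm_aeval_lt_one p ha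
    obtain ⟨T, N, hN, hTN⟩ := RatDyn.exists_bound hp hp1 hd ha hQ hQa hs
    have hb : 1 < ‖(p : PadicComplex p)⁻¹‖ := by
      rw [norm_inv]
      exact (one_lt_inv₀ (norm_pos_iff.2 (Nat.cast_ne_zero.2 hp.ne_zero))).2 hp1
    refine (RatDyn.finite_setOf_critOrbit_eq hd hb (m := T + N) (n := T) (by omega)).subset ?_
    rintro c ⟨hca, hc⟩
    exact hTN c (by rwa [← dist_eq_norm]) (hc.exists_critOrbit_eq hd)
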